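/- Let $d\ge 1$ and $D=\binom{d+1}{2}$. Let $G=(V,E)$ be a finite graph (parallel edges and loops are allowed), let $\mathbf R$ be a finite multiset of vertices of $G$ (the roots), and let $\mathbf p^\circ:\mathbf R\to\mathbb R^d$ be a map (the pin positions; a vertex may carry several pins). For $v\in V$ and $X\subseteq V$ let $\mathbf R_v$ and $\mathbf R_X$ be the multisets of those roots that equal $v$, respectively lie in $X$. Let $Gr(2,\mathbb R^{d+1})$ be the set of $2$-dimensional linear subspaces of $\mathbb R^{d+1}$. A bar-configuration is a map $\mathbf b:E\to Gr(2,\mathbb R^{d+1})$; write $\mathbf b_e=x\wedge y\in\bigwedge^2\mathbb R^{d+1}$ for any basis $x,y$ of $\mathbf b(e)$, which is determined up to a nonzero factor. For $a\in\bigwedge^{d-1}\mathbb R^{d+1}$ and $c\in\bigwedge^{2}\mathbb R^{d+1}$ put $\langle a,c\rangle:=\langle a,\ast c\rangle$, where $\ast$ is the Hodge star and the right-hand side is the standard Euclidean inner product. An infinitesimal motion of the pinned body-bar framework $(G,\mathbf R;\mathbf b,\mathbf p^\circ)$ is a map $\mathbf m:V\to\bigwedge^{d-1}\mathbb R^{d+1}$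 such that $$\langle \mathbf m(u)-\mathbf m(v),\mathbf b_e\rangle=0\quad\text{for every } e=uv\in E,$$ $$\langle \mathbf m(v),(\mathbf p^\circ(r),1)\wedge(q,1)\rangle=0\quad\text{for all } v\in V,\ r\in\mathbf R_v,\ q\in\mathbb R^d.$$ The framework is infinitesimally rigid if its only infinitesimal motion is $\mathbf m=0$. Theorem. There exists a bar-configuration $\mathbf b:E\to Gr(2,\mathbb R^{d+1})$ such that $(G,\mathbf R;\mathbf b,\mathbf p^\circ)$ is infinitesimally rigid if and only if $$|\delta_G(\mathcal P)|\ \ge\ D|\mathcal P|-\sum_{X\in\mathcal P,\ \mathbf R_X\ne\emptyset}\ \sum_{i=1}^{d_X+1}(d-i+1)$$ for every partition $\mathcal P$ of $V$ into non-empty subsets, where $\delta_G(\mathcal P)$ is the set of edges of $G$ connecting two distinct members of $\mathcal P$ and $d_X$ is the dimension of the affine span of $\mathbf p^\circ(\mathbf R_X)$. -/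

import Mathlib

open scoped Graph InnerProductSpace

namespace BodyBar

/-- The real vector space `ℝⁿ` with its standard inner product. -/
abbrev Euc (n : ℕ) : Type := EuclideanSpace ℝ (Fin n)

/-- The basis `e_I = e_{i₁} ∧ ⋯ ∧ e_{i_k}`, `I = {i₁ < ⋯ < i_k}`, of `⋀ᵏ ℝⁿ` coming from the
standard basis of `ℝⁿ`. -/
noncomputable def stdBasis (n k : ℕ) :
    Module.Basis (Set.powersetCard (Fin n) k) ℝ (⋀[ℝ]^k (Euc n)) :=
  (EuclideanSpace.basisFun (Fin n) ℝ).toBasis.exteriorPower k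

/-- The sign `σ_I` with `e_I ∧ e_{Iᶜ} = σ_I e₁ ∧ ⋯ ∧ e_n`: it is `-1` to the number of pairs
`(i, j)` with `i ∈ I`, `j ∉ I` and `j < i`. -/
def shuffleSign {n : ℕ} (I : Finset (Fin n)) : ℝ :=
  (-1) ^ ((I ×ˢ Iᶜ).filter fun x => x.2 < x.1).card

/-- The Hodge star `⋀ᵏ ℝⁿ → ⋀ˡ ℝⁿ`, `l + k = n`: the linear map with `∗ e_I = σ_I e_{Iᶜ}`. -/
noncomputable def hodgeStar {n k l : ℕ} (h : l + k = n) :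
    ⋀[ℝ]^k (Euc n) →ₗ[ℝ] ⋀[ℝ]^l (Euc n) :=
  (stdBasis n k).constr ℝ fun I =>
    shuffleSign (I : Finset (Fin n)) •
      stdBasis n l (Set.powersetCard.compl (h.trans (Fintype.card_fin n).symm) I)

/-- The space `⋀^{d-1} ℝ^{d+1}` of infinitesimal motions of one rigid body in `ℝᵈ`. -/
abbrev Screw (d : ℕ) : Type := ⋀[ℝ]^(d - 1) (Euc (d + 1))

/-- The pairing `⟨a, b⟩ := ⟨a, ∗b⟩` of `a ∈ ⋀^{d-1} ℝ^{d+1}` with `b ∈ ⋀² ℝ^{d+1}`, where `⟨·, ·⟩` on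
the right is the standard inner product of `⋀^{d-1} ℝ^{d+1}`, for which the `e_I` are orthonormal. -/
noncomputable def pairing {d : ℕ} (hd : 1 ≤ d) (a : Screw d) (b : ⋀[ℝ]^2 (Euc (d + 1))) : ℝ :=
  ⟪a, hodgeStar (show d - 1 + 2 = d + 1 by omega) b⟫_ℝ

/-- The Grassmannian `Gr(k, ℝⁿ)` of `k`-dimensional linear subspaces. -/
def Gr (k n : ℕ) : Type := {W : Submodule ℝ (Euc n) // Module.finrank ℝ W = k}

/-- The set of representatives `v₁ ∧ ⋯ ∧ v_k` (`v₁, …, v_k` a basis of `W`) of the point of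
`ℙ(⋀ᵏ ℝⁿ)` that the Plücker embedding assigns to `W`. -/
def Gr.pluckerVectors {k n : ℕ} (W : Gr k n) : Set (⋀[ℝ]^k (Euc n)) :=
  {ω | ∃ v : Fin k → Euc n, LinearIndependent ℝ v ∧
    Submodule.span ℝ (Set.range v) = W.1 ∧ ω = exteriorPower.ιMulti ℝ k v}

/-- The homogeneous coordinates `(p, 1) ∈ ℝ^{d+1}` of a point `p ∈ ℝᵈ`. -/
noncomputable def homog {d : ℕ} (p : Euc d) : Euc (d + 1) :=
  WithLp.toLp 2 (Fin.snoc (α := fun _ => ℝ) p.ofLp 1)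

variable {α β ρ : Type*}

/-- `m` is an infinitesimal motion of the pinned body-bar framework `(G, R; b, p)`. The multiset
of roots is the family `R`, indexed by `ρ`. The condition does not depend on the representative
of a Plücker coordinate. -/
def IsInfinitesimalMotion {d : ℕ} (hd : 1 ≤ d) (G : Graph α β) (R : ρ → V(G))
    (b : E(G) → Gr 2 (d + 1)) (p : ρ → Euc d) (m : V(G) → Screw d) : Prop :=
  (∀ (e : E(G)) (u v : V(G)), G.IsLink e u v →
    ∀ ω ∈ (b e).pluckerVectors, pairing hd (m u - m v) ω = 0) ∧
  ∀ (r : ρ) (q : Euc d),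
    pairing hd (m (R r)) (exteriorPower.ιMulti ℝ 2 ![homog (p r), homog q]) = 0

/-- The pinned body-bar framework `(G, R; b, p)` has no nonzero infinitesimal motion. -/
def IsInfinitesimallyRigid {d : ℕ} (hd : 1 ≤ d) (G : Graph α β) (R : ρ → V(G))
    (b : E(G) → Gr 2 (d + 1)) (p : ρ → Euc d) : Prop :=
  ∀ m : V(G) → Screw d, IsInfinitesimalMotion hd G R b p m → m = 0

/-- `δ_G(P)`: the edges of `G` that connect two distinct parts of the partition `P` of `V(G)`. -/
def crossingEdges (G : Graph α β) (P : Finpartition V(G)) : Set β :=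
  {e | ∃ u v, G.IsLink e u v ∧ ∃ X ∈ P.parts, ∃ Y ∈ P.parts, X ≠ Y ∧ u ∈ X ∧ v ∈ Y}

/-- `R_X`: the roots lying in the vertex set `X`. -/
def rootsIn {G : Graph α β} (R : ρ → V(G)) (X : Set α) : Set ρ := {r | (R r : α) ∈ X}

/-- The dimension of the affine span of a set of points. -/
noncomputable def affineDim {d : ℕ} (S : Set (Euc d)) : ℕ :=
  Module.finrank ℝ (affineSpan ℝ S).direction

end BodyBar

/-! Let K_X be the space of screws fixing every pin in X. Motions satisfying the pin conditions form
M = ∏ K_v. A bar along e = uv gives one linear form m ↦ ⟨m(u) - m(v), b_e⟩ on M, and rigidity says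
that the chosen forms span the dual of M. So the question is whether the sets S_e of forms available
at the edges have a spanning transversal. Rado's theorem answers it: it suffices that for every edge
set F the common zero space N of all forms in S_e, e ∈ F, satisfies dim N ≤ |E ∖ F|.

Decomposable bivectors separate screws, so elements of N agree at the ends of each edge of F. Group
vertices on which all of N agree. An element of N is given by one screw per part X, lying in K_X,
and crossing edges avoid F; hence dim N ≤ ∑ dim K_X ≤ |δ(P)| ≤ |E ∖ F|
(`exists_bars_of_partition_count`). Conversely, on motions constant on the parts only crossing edges
impose conditions, one each, so rigidity forces ∑ dim K_X ≤ |δ(P)|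
(`sum_finrank_le_ncard_crossingEdges`).

It remains to compute dim K_X. The pairing turns K_X into the forms on ⋀²ℝ^{d+1} killing U ∧
ℝ^{d+1}, with U spanned by the homogenized pins. This is the dual of ⋀² of a complement of U, which
gives the stated sum (`finrank_fixing_eq`). -/

/-! ### Rado's theorem on spanning transversals -/

open Module in
/-- One can replace one set of a family by one of its elements without violating the Rado
condition. -/
theorem exists_mem_update_rado {E Q : Type*} [Fintype E] [DecidableEq E] [AddCommGroup Q]
    [Module ℝ Q] [FiniteDimensional ℝ Q] (S : E → Set Q) (e : E) (hne : (S e).Nonempty)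
    (H : ∀ F : Finset E,
      finrank ℝ Q ≤ finrank ℝ (Submodule.span ℝ (⋃ i ∈ F, S i)) + Fᶜ.card) :
    ∃ x ∈ S e, ∀ F : Finset E, finrank ℝ Q ≤
      finrank ℝ (Submodule.span ℝ (⋃ i ∈ F, Function.update S e {x} i)) + Fᶜ.card := by
  by_contra! hcon
  let r : Finset E → Submodule ℝ Q := fun F => Submodule.span ℝ (⋃ i ∈ F, S i)
  -- Tight sets avoiding e: the Rado inequality is an equality there. If x is a bad choice, it lies
  -- in the span of such a set.
  let T : Finset E → Prop := fun F => e ∉ F ∧ finrank ℝ (r F) + Fᶜ.card ≤ finrank ℝ Q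
  have rmono : ∀ {F F' : Finset E}, F ⊆ F' → r F ≤ r F' := fun h =>
    Submodule.span_mono (Set.biUnion_subset_biUnion_left h)
  have runion : ∀ F F', r (F ∪ F') = r F ⊔ r F' := fun F F' => by
    simp only [r, ← Submodule.span_union, Finset.set_biUnion_union]
  have key : ∀ x ∈ S e, ∃ F, T F ∧ x ∈ r F := by
    intro x hx
    obtain ⟨F, hF⟩ := hcon x hx
    have heq : (⋃ i ∈ F.erase e, Function.update S e {x} i) = ⋃ i ∈ F.erase e, S i := by
      refine Set.iUnion₂_congr fun i hi => ?_
      rw [Function.update_of_ne (Finset.ne_of_mem_erase hi)]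
    have heF : e ∈ F := by
      by_contra h
      rw [Finset.erase_eq_of_notMem h] at heq
      rw [heq] at hF
      exact absurd (H F) (not_le.2 hF)
    have hle : r (F.erase e) ≤ Submodule.span ℝ (⋃ i ∈ F, Function.update S e {x} i) := by
      simp only [r]
      rw [← heq]
      exact Submodule.span_mono (Set.biUnion_subset_biUnion_left (Finset.erase_subset _ _))
    have hxm : x ∈ Submodule.span ℝ (⋃ i ∈ F, Function.update S e {x} i) :=
      Submodule.subset_span (Set.mem_biUnion (show e ∈ (F : Set E) from heF) (by simp))
    have hc : (F.erase e)ᶜ.card = Fᶜ.card + 1 := by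
      have h1 := Finset.card_erase_add_one heF
      have h2 := Finset.card_add_card_compl F
      have h3 := Finset.card_add_card_compl (F.erase e)
      omega
    have h1 := H (F.erase e)
    have h2 := Submodule.finrank_mono hle
    have hE := Submodule.eq_of_le_of_finrank_le hle (by simp only [r]; omega)
    refine ⟨F.erase e, ⟨by simp, ?_⟩, hE ▸ hxm⟩
    omega
  -- Submodularity of rank, with the Rado inequality on the intersection.
  have Tunion : ∀ F F', T F → T F' → T (F ∪ F') := by
    rintro F F' ⟨h1, h2⟩ ⟨h3, h4⟩
    refine ⟨by simp [h1, h3], ?_⟩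
    have h5 := Submodule.finrank_sup_add_finrank_inf_eq (r F) (r F')
    rw [← runion] at h5
    have h6 : finrank ℝ (r (F ∩ F')) ≤ finrank ℝ (r F ⊓ r F' : Submodule ℝ Q) :=
      Submodule.finrank_mono
        (le_inf (rmono Finset.inter_subset_left) (rmono Finset.inter_subset_right))
    have h7 : finrank ℝ Q ≤ finrank ℝ (r (F ∩ F')) + (F ∩ F')ᶜ.card := H (F ∩ F')
    have h8 := Finset.card_union_add_card_inter F F'
    have := Finset.card_add_card_compl F
    have := Finset.card_add_card_compl F'
    have := Finset.card_add_card_compl (F ∩ F')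
    have := Finset.card_add_card_compl (F ∪ F')
    omega
  obtain ⟨x₀, hx₀⟩ := hne
  obtain ⟨F₀, hF₀, -⟩ := key x₀ hx₀
  -- The maximal tight set contains all others, so its span contains S e. Adding e then shrinks the
  -- complement without raising the rank, which violates the Rado inequality.
  obtain ⟨M, hM⟩ := (Set.toFinite {F | T F}).exists_maximal ⟨F₀, hF₀⟩
  have hsub : S e ⊆ r M := by
    intro x hx
    obtain ⟨F, hF, hxF⟩ := key x hx
    have h1 : M ∪ F ≤ M := hM.2 (Tunion _ _ hM.1 hF) Finset.subset_union_left
    exact rmono (Finset.subset_union_right.trans h1) hxF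
  have hins : r (insert e M) ≤ r M := by
    refine Submodule.span_le.2 ?_
    rw [Finset.set_biUnion_insert]
    exact Set.union_subset hsub Submodule.subset_span
  have h1 : finrank ℝ Q ≤ finrank ℝ (r (insert e M)) + (insert e M)ᶜ.card := H (insert e M)
  have h2 := Submodule.finrank_mono hins
  have h3 := hM.1.2
  have h4 := Finset.card_insert_of_notMem hM.1.1
  have := Finset.card_add_card_compl M
  have := Finset.card_add_card_compl (insert e M)
  omega

open Module in
/-- Rado's theorem, in the form: a finite family of nonempty sets of vectors has a transversal that
spans the whole space if for each subfamily, the codimension of its span is at most the number of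
sets outside the subfamily. -/
theorem exists_transversal_span_eq_top {E Q : Type*} [Fintype E] [DecidableEq E] [AddCommGroup Q]
    [Module ℝ Q] [FiniteDimensional ℝ Q] (S : E → Set Q) (hne : ∀ e, (S e).Nonempty)
    (H : ∀ F : Finset E,
      finrank ℝ Q ≤ finrank ℝ (Submodule.span ℝ (⋃ i ∈ F, S i)) + Fᶜ.card) :
    ∃ x : E → Q, (∀ e, x e ∈ S e) ∧ Submodule.span ℝ (Set.range x) = ⊤ := by
  have key : ∀ T : Finset E, ∃ S' : E → Set Q, (∀ e, S' e ⊆ S e) ∧ (∀ e, (S' e).Nonempty) ∧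
      (∀ e ∈ T, ∃ x, S' e = {x}) ∧ ∀ F : Finset E,
        finrank ℝ Q ≤ finrank ℝ (Submodule.span ℝ (⋃ i ∈ F, S' i)) + Fᶜ.card := by
    intro T
    induction T using Finset.induction_on with
    | empty => exact ⟨S, fun _ => subset_rfl, hne, by simp, H⟩
    | insert a T _ ih =>
      obtain ⟨S', h1, h2, h3, h4⟩ := ih
      obtain ⟨x, hx, h5⟩ := exists_mem_update_rado S' a (h2 a) h4
      refine ⟨Function.update S' a {x}, fun e => ?_, fun e => ?_, fun e he => ?_, h5⟩
      · by_cases h : e = a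
        · subst h; simpa using h1 e hx
        · simpa [h] using h1 e
      · by_cases h : e = a
        · subst h; simp
        · simpa [h] using h2 e
      · by_cases h : e = a
        · subst h; simp
        · simpa [h] using h3 e (by simpa [h] using he)
  obtain ⟨S', h1, -, h3, h4⟩ := key Finset.univ
  choose x hx using fun e => h3 e (Finset.mem_univ e)
  refine ⟨x, fun e => h1 e (by simp [hx e]), ?_⟩
  have h5 := h4 Finset.univ
  have h6 : (⋃ i ∈ (Finset.univ : Finset E), S' i) = Set.range x := by
    ext; simp [hx, eq_comm]
  rw [h6] at h5
  exact Submodule.eq_top_of_finrank_eq (le_antisymm (Submodule.finrank_le _) (by simpa using h5))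

/-! ### Forms on the exterior square that annihilate a subspace -/

namespace BodyBar
open Module

/-- The linear forms on `⋀² V` that vanish on `u ∧ w` whenever `u ∈ U`. -/
def wedgeAnnihilator {V : Type*} [AddCommGroup V] [Module ℝ V] (U : Submodule ℝ V) :
    Submodule ℝ (Dual ℝ (⋀[ℝ]^2 V)) where
  carrier := {φ | ∀ u ∈ U, ∀ w, φ (exteriorPower.ιMulti ℝ 2 ![u, w]) = 0}
  zero_mem' := by simp
  add_mem' := fun ha hb u hu w => by simp [ha u hu w, hb u hu w]
  smul_mem' := fun c a ha u hu w => by simp [ha u hu w]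

theorem wedge_add_left {V : Type*} [AddCommGroup V] [Module ℝ V] (x y z : V) :
    exteriorPower.ιMulti ℝ 2 ![x + y, z] =
      exteriorPower.ιMulti ℝ 2 ![x, z] + exteriorPower.ιMulti ℝ 2 ![y, z] :=
  (exteriorPower.ιMulti ℝ 2 (M := V)).map_vecCons_add ![z] x y

theorem wedge_smul_left {V : Type*} [AddCommGroup V] [Module ℝ V] (c : ℝ) (x z : V) :
    exteriorPower.ιMulti ℝ 2 ![c • x, z] = c • exteriorPower.ιMulti ℝ 2 ![x, z] :=
  (exteriorPower.ιMulti ℝ 2 (M := V)).map_vecCons_smul ![z] c x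

theorem wedge_swap {V : Type*} [AddCommGroup V] [Module ℝ V] (x y : V) :
    exteriorPower.ιMulti ℝ 2 ![y, x] = -exteriorPower.ιMulti ℝ 2 ![x, y] := by
  rw [← (exteriorPower.ιMulti ℝ 2 (M := V)).map_swap ![x, y] (show (0 : Fin 2) ≠ 1 by decide)]
  congr 1
  ext i
  fin_cases i <;> simp

theorem wedge_self {V : Type*} [AddCommGroup V] [Module ℝ V] (x : V) :
    exteriorPower.ιMulti ℝ 2 ![x, x] = 0 :=
  (exteriorPower.ιMulti ℝ 2 (M := V)).map_eq_zero_of_eq ![x, x] (i := 0) (j := 1) rfl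
    (by decide)

theorem wedge_add_right {V : Type*} [AddCommGroup V] [Module ℝ V] (x y z : V) :
    exteriorPower.ιMulti ℝ 2 ![z, x + y] =
      exteriorPower.ιMulti ℝ 2 ![z, x] + exteriorPower.ιMulti ℝ 2 ![z, y] := by
  rw [wedge_swap, wedge_add_left, neg_add, ← wedge_swap, ← wedge_swap]

theorem wedge_smul_right {V : Type*} [AddCommGroup V] [Module ℝ V] (c : ℝ) (x z : V) :
    exteriorPower.ιMulti ℝ 2 ![z, c • x] = c • exteriorPower.ιMulti ℝ 2 ![z, x] := by
  rw [wedge_swap, wedge_smul_left, wedge_swap z x, smul_neg, neg_neg]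

/-- Such a form is determined by its restriction to ⋀² of a complement U' of U, and any form there
extends by pulling back along the projection π onto U'. -/
theorem finrank_wedgeAnnihilator {V : Type*} [AddCommGroup V] [Module ℝ V]
    [FiniteDimensional ℝ V] (U : Submodule ℝ V) :
    finrank ℝ (wedgeAnnihilator U) = (finrank ℝ V - finrank ℝ U).choose 2 := by
  obtain ⟨U', hU⟩ := U.exists_isCompl
  let π : V →ₗ[ℝ] U' := U'.projectionOnto U hU.symm
  have hπU : ∀ u ∈ U, π u = 0 := fun u hu => by
    simpa [π] using hu
  have hπ : π ∘ₗ U'.subtype = LinearMap.id := by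
    ext x; simp [π]
  have hsub : ∀ v : V, v - (π v : V) ∈ U := fun v => by
    have : π (v - (π v : V)) = 0 := by
      have h := LinearMap.congr_fun hπ (π v)
      simp only [LinearMap.comp_apply, Submodule.subtype_apply, LinearMap.id_apply] at h
      rw [map_sub, h, sub_self]
    exact (Submodule.projectionOnto_apply_eq_zero_iff hU.symm).1 this
  let f : wedgeAnnihilator U →ₗ[ℝ] Dual ℝ (⋀[ℝ]^2 U') :=
    (exteriorPower.map 2 U'.subtype).dualMap ∘ₗ (wedgeAnnihilator U).subtype
  have hval : ∀ (φ : wedgeAnnihilator U) (v : Fin 2 → V), φ.1 (exteriorPower.ιMulti ℝ 2 v) =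
      f φ (exteriorPower.ιMulti ℝ 2 ![π (v 0), π (v 1)]) := by
    intro φ v
    have h1 : v = ![v 0, v 1] := by ext i; fin_cases i <;> rfl
    have h2 : f φ (exteriorPower.ιMulti ℝ 2 ![π (v 0), π (v 1)]) =
        φ.1 (exteriorPower.ιMulti ℝ 2 ![(π (v 0) : V), (π (v 1) : V)]) := by
      simp only [f, LinearMap.comp_apply, LinearMap.dualMap_apply,
        exteriorPower.map_apply_ιMulti, Submodule.subtype_apply]
      congr 2
    have h3 := φ.2 _ (hsub (v 0)) (v 1)
    have h4 := φ.2 _ (hsub (v 1)) (π (v 0))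
    rw [wedge_swap, map_neg, neg_eq_zero] at h4
    have e1 : v 0 = (π (v 0) : V) + (v 0 - (π (v 0) : V)) := by abel
    have e2 : v 1 = (π (v 1) : V) + (v 1 - (π (v 1) : V)) := by abel
    have h5 : exteriorPower.ιMulti ℝ 2 v =
        exteriorPower.ιMulti ℝ 2 ![(π (v 0) : V), (π (v 1) : V)] +
        exteriorPower.ιMulti ℝ 2 ![(π (v 0) : V), v 1 - (π (v 1) : V)] +
        exteriorPower.ιMulti ℝ 2 ![v 0 - (π (v 0) : V), v 1] := by
      rw [← wedge_add_right, ← e2, ← wedge_add_left, ← e1, ← h1]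
    rw [h2, h5, map_add, map_add, h3, h4, add_zero, add_zero]
  have hf : Function.Bijective f := by
    constructor
    · intro φ φ' h
      refine Subtype.ext (exteriorPower.linearMap_ext (AlternatingMap.ext fun v => ?_))
      simp only [LinearMap.compAlternatingMap_apply]
      rw [hval, hval, h]
    · intro ψ
      refine ⟨⟨(exteriorPower.map 2 π).dualMap ψ, fun u hu w => ?_⟩, ?_⟩
      · rw [LinearMap.dualMap_apply, exteriorPower.map_apply_ιMulti]
        -- Zero is written as a scalar multiple so that `wedge_smul_left` applies.
        have : (π ∘ ![u, w]) = ![(0 : ℝ) • 0, π w] := by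
          ext i; fin_cases i <;> simp [hπU u hu]
        rw [this, wedge_smul_left, zero_smul, map_zero]
      · ext v
        simp only [f, LinearMap.comp_apply, Submodule.subtype_apply, LinearMap.dualMap_apply,
          LinearMap.compAlternatingMap_apply, exteriorPower.map_apply_ιMulti]
        rw [← Function.comp_assoc, ← LinearMap.coe_comp, hπ]
        rfl
  rw [(LinearEquiv.ofBijective f hf).finrank_eq, Subspace.dual_finrank_eq,
    exteriorPower.finrank_eq]
  have := Submodule.finrank_add_eq_of_isCompl hU
  congr 1
  omega

/-! ### The pairing, and screws fixing a set of points -/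

theorem hodgeStar_surjective {n k l : ℕ} (h : l + k = n) :
    Function.Surjective (hodgeStar h) := by
  rw [← LinearMap.range_eq_top, eq_top_iff, ← (stdBasis n l).span_eq, Submodule.span_le]
  rintro _ ⟨J, rfl⟩
  obtain ⟨I, rfl⟩ := (Set.powersetCard.compl
    (h.trans (Fintype.card_fin n).symm)).surjective J
  have hs : shuffleSign (I : Finset (Fin n)) ≠ 0 := by simp [shuffleSign]
  refine ⟨(shuffleSign (I : Finset (Fin n)))⁻¹ • stdBasis n k I, ?_⟩
  rw [map_smul, hodgeStar, Basis.constr_basis, smul_smul, inv_mul_cancel₀ hs, one_smul]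

/-- The pairing as a linear map. -/
noncomputable def pairingDual {d : ℕ} (hd : 1 ≤ d) :
    Screw d →ₗ[ℝ] Dual ℝ (⋀[ℝ]^2 (Euc (d + 1))) :=
  (hodgeStar (show d - 1 + 2 = d + 1 by omega)).dualMap ∘ₗ innerₗ (Screw d)

theorem pairingDual_apply {d : ℕ} (hd : 1 ≤ d) (a : Screw d) (b : ⋀[ℝ]^2 (Euc (d + 1))) :
    pairingDual hd a b = pairing hd a b := rfl

theorem finrank_screw {d : ℕ} (hd : 1 ≤ d) : finrank ℝ (Screw d) = (d + 1).choose 2 := by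
  rw [exteriorPower.finrank_eq, finrank_euclideanSpace_fin]
  exact Nat.choose_symm_of_eq_add (by omega)

theorem pairingDual_injective {d : ℕ} (hd : 1 ≤ d) : Function.Injective (pairingDual hd) := by
  refine (injective_iff_map_eq_zero _).2 fun a ha => ?_
  obtain ⟨b, hb⟩ := hodgeStar_surjective (show d - 1 + 2 = d + 1 by omega) a
  have h : ⟪a, hodgeStar (show d - 1 + 2 = d + 1 by omega) b⟫_ℝ = 0 :=
    LinearMap.congr_fun ha b
  rw [hb] at h
  exact inner_self_eq_zero.1 h

/-- The pairing identifies the space of screws with the dual of `⋀²`. -/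
noncomputable def pairingEquiv {d : ℕ} (hd : 1 ≤ d) :
    Screw d ≃ₗ[ℝ] Dual ℝ (⋀[ℝ]^2 (Euc (d + 1))) :=
  LinearEquiv.ofInjectiveOfFinrankEq (pairingDual hd) (pairingDual_injective hd) (by
    rw [finrank_screw hd, Subspace.dual_finrank_eq, exteriorPower.finrank_eq,
      finrank_euclideanSpace_fin])

/-- The screws that keep all the points of `S` fixed. -/
noncomputable def fixing {d : ℕ} (hd : 1 ≤ d) (S : Set (Euc d)) : Submodule ℝ (Screw d) :=
  (wedgeAnnihilator (Submodule.span ℝ (homog '' S))).comap (pairingDual hd)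

theorem homog_apply_last {d : ℕ} (p : Euc d) : homog p (Fin.last d) = 1 := by
  simp [homog]

theorem homog_apply_castSucc {d : ℕ} (p : Euc d) (i : Fin d) : homog p i.castSucc = p i := by
  simp [homog]

theorem span_range_homog (d : ℕ) : Submodule.span ℝ (Set.range (homog (d := d))) = ⊤ := by
  refine eq_top_iff.2 fun v _ => ?_
  have : v = homog (WithLp.toLp 2 fun i => v i.castSucc) + (v (Fin.last d) - 1) • homog 0 := by
    ext i
    refine Fin.lastCases ?_ (fun j => ?_) i
    · simp [homog_apply_last]
    · simp [homog_apply_castSucc]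
  rw [this]
  exact Submodule.add_mem _ (Submodule.subset_span ⟨_, rfl⟩)
    (Submodule.smul_mem _ _ (Submodule.subset_span ⟨_, rfl⟩))

/-- The vectors (q, 1) span ℝ^{d+1}, so bilinearity extends the pin condition to all w. -/
theorem mem_fixing {d : ℕ} {hd : 1 ≤ d} {S : Set (Euc d)} {a : Screw d} :
    a ∈ fixing hd S ↔ ∀ x ∈ S, ∀ q,
      pairing hd a (exteriorPower.ιMulti ℝ 2 ![homog x, homog q]) = 0 := by
  refine ⟨fun h x hx q => h _ (Submodule.subset_span ⟨x, hx, rfl⟩) _, fun h u hu w => ?_⟩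
  have hw : w ∈ Submodule.span ℝ (Set.range (homog (d := d))) := by
    rw [span_range_homog]; trivial
  induction hu using Submodule.span_induction with
  | mem u hu =>
    obtain ⟨x, hx, rfl⟩ := hu
    induction hw using Submodule.span_induction with
    | mem w hw => obtain ⟨q, rfl⟩ := hw; exact h x hx q
    | zero => rw [← zero_smul ℝ (0 : Euc (d + 1)), wedge_smul_right, zero_smul, map_zero]
    | add y z _ _ hy hz => rw [wedge_add_right, map_add, hy, hz, add_zero]
    | smul c y _ hy => rw [wedge_smul_right, map_smul, hy, smul_zero]
  | zero => rw [← zero_smul ℝ (0 : Euc (d + 1)), wedge_smul_left, zero_smul, map_zero]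
  | add y z _ _ hy hz => rw [wedge_add_left, map_add, hy, hz, add_zero]
  | smul c y _ hy => rw [wedge_smul_left, map_smul, hy, smul_zero]

theorem finrank_fixing {d : ℕ} (hd : 1 ≤ d) (S : Set (Euc d)) : finrank ℝ (fixing hd S) =
    (d + 1 - finrank ℝ (Submodule.span ℝ (homog '' S))).choose 2 := by
  have h := finrank_wedgeAnnihilator (Submodule.span ℝ (homog '' S))
  rw [finrank_euclideanSpace_fin] at h
  rw [← h]
  exact ((pairingEquiv hd).ofSubmodule' _).finrank_eq

/-- The span is the direct sum of the direction space, embedded at last coordinate 0 by `L`, and the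
line through one (x₀, 1). -/
theorem finrank_span_homog {d : ℕ} {S : Set (Euc d)} (hS : S.Nonempty) :
    finrank ℝ (Submodule.span ℝ (homog '' S)) = affineDim S + 1 := by
  obtain ⟨x₀, hx₀⟩ := hS
  let L : Euc d →ₗ[ℝ] Euc (d + 1) :=
    { toFun := fun p => WithLp.toLp 2 (Fin.snoc (α := fun _ => ℝ) p.ofLp 0)
      map_add' := fun p q => by
        ext i; refine Fin.lastCases ?_ (fun j => ?_) i <;> simp
      map_smul' := fun c p => by
        ext i; refine Fin.lastCases ?_ (fun j => ?_) i <;> simp }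
  have hL : ∀ p q, L (p - q) = homog p - homog q := fun p q => by
    ext i; refine Fin.lastCases ?_ (fun j => ?_) i <;> simp [L, homog]
  have hlast : ∀ p, L p (Fin.last d) = 0 := fun p => by simp [L]
  have hLinj : Function.Injective L := by
    intro p q h
    ext i
    have := congrArg (fun v : Euc (d + 1) => v i.castSucc) h
    simpa [L] using this
  have hne : homog x₀ ≠ 0 := fun h => by
    have := homog_apply_last x₀
    rw [h] at this
    simp at this
  have hspan : Submodule.span ℝ (homog '' S) =
      (vectorSpan ℝ S).map L ⊔ Submodule.span ℝ {homog x₀} := by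
    rw [vectorSpan_eq_span_vsub_set_right ℝ hx₀, Submodule.map_span, ← Submodule.span_union]
    apply le_antisymm <;> rw [Submodule.span_le]
    · rintro _ ⟨x, hx, rfl⟩
      rw [← sub_add_cancel (homog x) (homog x₀), ← hL]
      exact Submodule.add_mem _ (Submodule.subset_span (Or.inl ⟨_, ⟨x, hx, rfl⟩, rfl⟩))
        (Submodule.subset_span (Or.inr rfl))
    · rintro _ (⟨_, ⟨x, hx, rfl⟩, rfl⟩ | rfl)
      · simp only [vsub_eq_sub, hL]
        exact Submodule.sub_mem _ (Submodule.subset_span ⟨x, hx, rfl⟩)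
          (Submodule.subset_span ⟨x₀, hx₀, rfl⟩)
      · exact Submodule.subset_span ⟨x₀, hx₀, rfl⟩
  have hdisj : (vectorSpan ℝ S).map L ⊓ Submodule.span ℝ {homog x₀} = ⊥ := by
    rw [eq_bot_iff]
    rintro _ ⟨⟨p, -, rfl⟩, h2⟩
    obtain ⟨c, hc⟩ := Submodule.mem_span_singleton.1 h2
    have := congrArg (fun v : Euc (d + 1) => v (Fin.last d)) hc
    simp only [PiLp.smul_apply, homog_apply_last, hlast, smul_eq_mul, mul_one] at this
    rw [← hc, this, zero_smul]
    exact Submodule.zero_mem _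
  have h := Submodule.finrank_sup_add_finrank_inf_eq ((vectorSpan ℝ S).map L)
    (Submodule.span ℝ {homog x₀})
  rw [hdisj, finrank_bot, add_zero, ← hspan, finrank_span_singleton hne,
    ← (Submodule.equivMapOfInjective L hLinj _).finrank_eq] at h
  rw [h, affineDim, direction_affineSpan]

/-- Pascal's rule: raising k by one removes d - k, the summand at i = k + 1. The bound on k keeps
the natural subtraction exact. -/
theorem choose_two_sub_eq (d k : ℕ) (hk : k ≤ d + 1) :
    (((d + 1 - k).choose 2 : ℕ) : ℤ) =
      (d + 1).choose 2 - ∑ i ∈ Finset.Icc 1 k, ((d : ℤ) - i + 1) := by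
  induction k with
  | zero => simp
  | succ k ih =>
    have h := ih (by omega)
    rw [Finset.sum_Icc_succ_top (by omega)]
    obtain ⟨j, hj⟩ : ∃ j, d = k + j := ⟨d - k, by omega⟩
    rw [show d + 1 - k = j + 1 by omega, Nat.choose_succ_succ' j 1, Nat.choose_one_right] at h
    rw [show d + 1 - (k + 1) = j by omega]
    push_cast at h ⊢
    subst hj
    push_cast at h ⊢
    linarith

theorem finrank_fixing_eq {d : ℕ} (hd : 1 ≤ d) {S : Set (Euc d)} (hS : S.Nonempty) :
    (finrank ℝ (fixing hd S) : ℤ) =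
      (d + 1).choose 2 - ∑ i ∈ Finset.Icc 1 (affineDim S + 1), ((d : ℤ) - i + 1) := by
  rw [finrank_fixing, finrank_span_homog hS, choose_two_sub_eq]
  rw [← finrank_span_homog hS]
  exact (Submodule.finrank_le _).trans (by rw [finrank_euclideanSpace_fin])

theorem finrank_fixing_empty {d : ℕ} (hd : 1 ≤ d) :
    finrank ℝ (fixing hd ∅) = (d + 1).choose 2 := by
  rw [finrank_fixing, Set.image_empty, Submodule.span_empty, finrank_bot, Nat.sub_zero]

/-! ### Plücker vectors -/

theorem Gr.exists_mem_pluckerVectors {k n : ℕ} (W : Gr k n) : ∃ ω, ω ∈ W.pluckerVectors := by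
  have b : Basis (Fin k) ℝ W.1 := finBasisOfFinrankEq ℝ W.1 W.2
  refine ⟨_, fun i => b i, b.linearIndependent.map' W.1.subtype (Submodule.ker_subtype _), ?_, rfl⟩
  have := congrArg (Submodule.map W.1.subtype) b.span_eq
  rw [Submodule.map_span, ← Set.range_comp, Submodule.map_top, Submodule.range_subtype] at this
  exact this

theorem Gr.pluckerVectors_subset_span {n : ℕ} (W : Gr 2 n) {ω ω' : ⋀[ℝ]^2 (Euc n)}
    (h : ω ∈ W.pluckerVectors) (h' : ω' ∈ W.pluckerVectors) : ∃ c : ℝ, ω' = c • ω := by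
  obtain ⟨v, -, hv, rfl⟩ := h
  obtain ⟨w, -, hw, rfl⟩ := h'
  have key : ∀ i, ∃ a b : ℝ, a • v 0 + b • v 1 = w i := fun i => by
    have h1 : w i ∈ Submodule.span ℝ (Set.range v) := by
      rw [hv, ← hw]; exact Submodule.subset_span ⟨i, rfl⟩
    have h2 : Set.range v = {v 0, v 1} := by
      ext x; simp [Fin.exists_fin_two, eq_comm]
    rw [h2] at h1
    exact Submodule.mem_span_pair.1 h1
  obtain ⟨a, b, h0⟩ := key 0
  obtain ⟨a', b', h1⟩ := key 1
  have ev : v = ![v 0, v 1] := by ext i; fin_cases i <;> rfl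
  have ew : w = ![w 0, w 1] := by ext i; fin_cases i <;> rfl
  -- The determinant of the change of basis.
  refine ⟨a * b' - b * a', ?_⟩
  rw [ew, ← h0, ← h1]
  conv_rhs => rw [ev]
  simp only [wedge_add_left, wedge_add_right, wedge_smul_left, wedge_smul_right, wedge_self,
    wedge_swap (v 0) (v 1)]
  module

/-- Decomposable bivectors span ⋀², and those of dependent pairs are zero. -/
theorem eq_zero_of_forall_pairing_eq_zero {d : ℕ} (hd : 1 ≤ d) {a : Screw d}
    (h : ∀ W : Gr 2 (d + 1), ∀ ω ∈ W.pluckerVectors, pairing hd a ω = 0) : a = 0 := by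
  refine pairingDual_injective hd ?_
  rw [map_zero]
  ext v
  simp only [LinearMap.compAlternatingMap_apply, LinearMap.zero_apply]
  by_cases hv : LinearIndependent ℝ v
  · exact h ⟨Submodule.span ℝ (Set.range v), by rw [finrank_span_eq_card hv]; simp⟩ _
      ⟨v, hv, rfl, rfl⟩
  · rw [AlternatingMap.map_linearDependent _ _ hv, map_zero]

theorem nonempty_gr {k n : ℕ} (h : k ≤ n) : Nonempty (Gr k n) := by
  have hli : LinearIndependent ℝ fun i : Fin k =>
      EuclideanSpace.basisFun (Fin n) ℝ (Fin.castLE h i) :=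
    (EuclideanSpace.basisFun (Fin n) ℝ).toBasis.linearIndependent.comp _
      (Fin.castLE_injective h) |> fun h' => by
        rwa [OrthonormalBasis.coe_toBasis] at h'
  exact ⟨⟨Submodule.span ℝ (Set.range _), by rw [finrank_span_eq_card hli, Fintype.card_fin]⟩⟩

/-! ### Partitions and the counting condition -/

variable {α β ρ : Type*}

/-- The partition of a finite set into the fibres of a map. -/
theorem exists_finpartition_fibers {γ : Type*} {s : Set α} (hs : s.Finite) (f : s → γ) :
    ∃ P : Finpartition s, ∀ X ∈ P.parts, ∃ v : s, X = {w | ∃ h : w ∈ s, f ⟨w, h⟩ = f v} := by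
  classical
  have := hs.fintype
  let fib : s → Set α := fun v => {w | ∃ h : w ∈ s, f ⟨w, h⟩ = f v}
  have hself : ∀ v, (v : α) ∈ fib v := fun v => ⟨v.2, rfl⟩
  refine ⟨⟨Finset.univ.image fib, ?_, ?_, ?_⟩, fun X hX => ?_⟩
  · rw [Finset.supIndep_iff_pairwiseDisjoint]
    intro X hX Y hY hXY
    obtain ⟨v, -, rfl⟩ := Finset.mem_image.1 hX
    obtain ⟨w, -, rfl⟩ := Finset.mem_image.1 hY
    refine Set.disjoint_left.2 ?_
    rintro x ⟨hx, h1⟩ ⟨_, h2⟩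
    exact hXY (by simp only [fib, ← h1, h2])
  · refine le_antisymm (Finset.sup_le fun X hX => ?_) fun x hx => ?_
    · obtain ⟨v, -, rfl⟩ := Finset.mem_image.1 hX
      rintro x ⟨hx, -⟩
      exact hx
    · exact Finset.le_sup (f := id) (Finset.mem_image_of_mem fib (Finset.mem_univ ⟨x, hx⟩))
        (hself ⟨x, hx⟩)
  · intro h
    obtain ⟨v, -, hv⟩ := Finset.mem_image.1 h
    exact Set.notMem_empty (v : α) (hv.le (hself v))
  · obtain ⟨v, -, rfl⟩ := Finset.mem_image.1 hX
    exact ⟨v, rfl⟩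

theorem exists_mem_parts {s : Set α} (P : Finpartition s) (v : s) :
    ∃ X : P.parts, (v : α) ∈ (X : Set α) := by
  have h : (v : α) ∈ P.parts.sup id := by rw [P.sup_parts]; exact v.2
  rw [Finset.sup_id_set_eq_sUnion] at h
  obtain ⟨X, hX, hv⟩ := h
  exact ⟨⟨X, hX⟩, hv⟩

theorem parts_eq_of_mem {s : Set α} (P : Finpartition s) {X Y : P.parts} {v : α}
    (hX : v ∈ (X : Set α)) (hY : v ∈ (Y : Set α)) : X = Y := by
  by_contra h
  exact Set.disjoint_left.1 (P.disjoint X.2 Y.2 fun h' => h (Subtype.ext h')) hX hY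

theorem exists_mem_of_parts {s : Set α} (P : Finpartition s) (X : P.parts) :
    ∃ v : s, (v : α) ∈ (X : Set α) := by
  obtain ⟨v, hv⟩ := Set.nonempty_iff_ne_empty.2 (P.ne_bot X.2)
  exact ⟨⟨v, P.le X.2 hv⟩, hv⟩

theorem mem_fixing_rootsIn {d : ℕ} {hd : 1 ≤ d} {G : Graph α β} {R : ρ → V(G)} {p : ρ → Euc d}
    {X : Set α} {a : Screw d} : a ∈ fixing hd (p '' rootsIn R X) ↔ ∀ r, (R r : α) ∈ X → ∀ q,
      pairing hd a (exteriorPower.ιMulti ℝ 2 ![homog (p r), homog q]) = 0 := by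
  rw [mem_fixing]
  exact Set.forall_mem_image

-- Each part contributes dim K_X. The filter matters: a rootless part contributes all of D, whereas
-- `affineDim ∅ = 0` would wrongly subtract d.
open Classical in
theorem count_le_iff {d : ℕ} (hd : 1 ≤ d) {G : Graph α β} (R : ρ → V(G)) (p : ρ → Euc d)
    (P : Finpartition V(G)) :
    ((d + 1).choose 2 : ℤ) * P.parts.card -
        ∑ X ∈ P.parts with (rootsIn R X).Nonempty,
          ∑ i ∈ Finset.Icc 1 (affineDim (p '' rootsIn R X) + 1), ((d : ℤ) - i + 1) ≤
      (crossingEdges G P).ncard ↔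
    ∑ X : P.parts, finrank ℝ (fixing hd (p '' rootsIn R X.1)) ≤ (crossingEdges G P).ncard := by
  rw [← Nat.cast_le (α := ℤ)]
  refine iff_of_eq (congrArg (· ≤ ((crossingEdges G P).ncard : ℤ)) ?_)
  rw [Finset.sum_coe_sort P.parts fun X => finrank ℝ (fixing hd (p '' rootsIn R X)),
    Finset.sum_filter, mul_comm, ← nsmul_eq_mul, ← Finset.sum_const, ← Finset.sum_sub_distrib,
    Nat.cast_sum]
  refine Finset.sum_congr rfl fun X _ => ?_
  split_ifs with h
  · rw [finrank_fixing_eq hd (h.image p)]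
  · rw [Set.not_nonempty_iff_eq_empty.1 h, Set.image_empty, finrank_fixing_empty, sub_zero]

theorem exists_isLink_of_edge {G : Graph α β} (e : E(G)) :
    ∃ u v : V(G), G.IsLink e u v := by
  obtain ⟨u, v, h⟩ := Graph.exists_isLink_of_mem_edgeSet e.2
  exact ⟨⟨u, h.left_mem⟩, ⟨v, h.right_mem⟩, h⟩

theorem crossingEdges_subset {G : Graph α β} (P : Finpartition V(G)) :
    crossingEdges G P ⊆ E(G) := by
  rintro e ⟨u, v, h, -⟩
  exact h.edge_mem

/-! ### Necessity and sufficiency of the count for linear systems -/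

section Count

variable {W Y : Type*} [AddCommGroup W] [Module ℝ W] [FiniteDimensional ℝ W] [AddCommGroup Y]
  [Module ℝ Y]

/-- If a system of bars admits no motion, then the degrees of freedom of the motions that are
constant on the parts of a partition are at most the number of crossing edges. -/
theorem sum_finrank_le_ncard_crossingEdges {G : Graph α β} (hE : E(G).Finite)
    (B : W →ₗ[ℝ] Y →ₗ[ℝ] ℝ) (ω : E(G) → Y) (P : Finpartition V(G))
    (K : P.parts → Submodule ℝ W)
    (h : ∀ m : V(G) → W,
      (∀ (e : E(G)) (u v : V(G)), G.IsLink e u v → B (m u - m v) (ω e) = 0) →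
      (∀ (X : P.parts) (v : V(G)), (v : α) ∈ (X : Set α) → m v ∈ K X) → m = 0) :
    ∑ X : P.parts, finrank ℝ (K X) ≤ (crossingEdges G P).ncard := by
  choose u w huw using fun e : E(G) => exists_isLink_of_edge e
  choose part hpart using exists_mem_parts P
  have : Finite (crossingEdges G P) := hE.subset (crossingEdges_subset P)
  have := Fintype.ofFinite (crossingEdges G P)
  let ι : crossingEdges G P → E(G) := fun e => ⟨e, crossingEdges_subset P e.2⟩
  let ext : ((X : P.parts) → K X) →ₗ[ℝ] (V(G) → W) :=
    LinearMap.pi fun v => (K (part v)).subtype ∘ₗ LinearMap.proj (part v)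
  let L : ((X : P.parts) → K X) →ₗ[ℝ] (crossingEdges G P → ℝ) :=
    LinearMap.pi fun e => (B.flip (ω (ι e)) ∘ₗ
      (LinearMap.proj (R := ℝ) (φ := fun _ : V(G) => W) (u (ι e)) - LinearMap.proj (R := ℝ) (φ := fun _ : V(G) => W) (w (ι e)))) ∘ₗ ext
  have hL : Function.Injective L := by
    refine LinearMap.ker_eq_bot.1 (LinearMap.ker_eq_bot'.2 fun n hn => ?_)
    have hext : ∀ v X, part v = X → ext n v = n X := by rintro v X rfl; rfl
    have hedge : ∀ e : E(G), B (ext n (u e) - ext n (w e)) (ω e) = 0 := by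
      intro e
      -- Edges inside a part impose nothing on motions constant on parts.
      by_cases he : part (u e) = part (w e)
      · rw [(hext _ _ he).trans (hext _ _ rfl).symm, sub_self, map_zero, LinearMap.zero_apply]
      · exact congrFun hn ⟨e, u e, w e, huw e, part (u e), (part (u e)).2, part (w e),
          (part (w e)).2, fun h' => he (Subtype.ext h'), hpart _, hpart _⟩
    have hm : ext n = 0 := by
      refine h _ (fun e x y hxy => ?_) fun X v hv => ?_
      · rcases hxy.eq_and_eq_or_eq_and_eq (huw e) with ⟨h1, h2⟩ | ⟨h1, h2⟩
        · rw [Subtype.ext h1, Subtype.ext h2, hedge]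
        · rw [Subtype.ext h1, Subtype.ext h2, ← neg_sub, map_neg, LinearMap.neg_apply, hedge,
            neg_zero]
      · obtain rfl := parts_eq_of_mem P (hpart v) hv
        exact (n (part v)).2
    funext X
    obtain ⟨v, hv⟩ := exists_mem_of_parts P X
    have h1 := congrFun hm v
    obtain rfl := parts_eq_of_mem P (hpart v) hv
    exact Subtype.ext h1
  have h1 := LinearMap.finrank_le_finrank_of_injective hL
  rwa [Module.finrank_pi_fintype, Module.finrank_fintype_fun_eq_card, ← Nat.card_eq_fintype_card,
    Nat.card_coe_set_eq] at h1

/-- Under the partition count, bars taken from a family of sets of linear forms that separates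
points can be chosen so that there is no nonzero motion. -/
theorem exists_bars_of_partition_count {G : Graph α β} (hV : V(G).Finite) (hE : E(G).Finite)
    (B : W →ₗ[ℝ] Y →ₗ[ℝ] ℝ) (K : Set α → Submodule ℝ W)
    (hK : ∀ (X : Set α) (a : W), (∀ v : V(G), (v : α) ∈ X → a ∈ K {(v : α)}) → a ∈ K X)
    {Γ : Type*} [Nonempty Γ] (C : Γ → Set Y) (hC : ∀ g, (C g).Nonempty)
    (hsep : ∀ a : W, (∀ g, ∀ ω ∈ C g, B a ω = 0) → a = 0)
    (h : ∀ P : Finpartition V(G),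
      ∑ X : P.parts, finrank ℝ (K X.1) ≤ (crossingEdges G P).ncard) :
    ∃ b : E(G) → Γ, ∀ m : V(G) → W, (∀ v : V(G), m v ∈ K {(v : α)}) →
      (∀ (e : E(G)) (u v : V(G)), G.IsLink e u v → ∀ ω ∈ C (b e), B (m u - m v) ω = 0) →
      m = 0 := by
  classical
  have := hV.fintype
  have := hE.fintype
  choose u w huw using fun e : E(G) => exists_isLink_of_edge e
  let M : Submodule ℝ (V(G) → W) := Submodule.pi Set.univ fun v => K {(v : α)}
  let φ : E(G) → Y → Dual ℝ M := fun e ω =>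
    (B.flip ω ∘ₗ (LinearMap.proj (R := ℝ) (φ := fun _ : V(G) => W) (u e) - LinearMap.proj (R := ℝ) (φ := fun _ : V(G) => W) (w e))) ∘ₗ M.subtype
  have hφ : ∀ e ω (m : M), φ e ω m = B (m.1 (u e) - m.1 (w e)) ω := fun _ _ _ => rfl
  let S : E(G) → Set (Dual ℝ M) := fun e => {ψ | ∃ g, ∃ ω ∈ C g, ψ = φ e ω}
  obtain ⟨g₀⟩ := ‹Nonempty Γ›
  obtain ⟨ω₀, hω₀⟩ := hC g₀
  have hS : ∀ F : Finset E(G),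
      finrank ℝ (Dual ℝ M) ≤ finrank ℝ (Submodule.span ℝ (⋃ i ∈ F, S i)) + Fᶜ.card := by
    intro F
    -- The codimension of the span is dim N, so the Rado condition becomes dim N ≤ |Fᶜ|.
    let N : Submodule ℝ M := (Submodule.span ℝ (⋃ i ∈ F, S i)).dualCoannihilator
    have hN : finrank ℝ (Submodule.span ℝ (⋃ i ∈ F, S i)) + finrank ℝ N = finrank ℝ M :=
      Subspace.finrank_add_finrank_dualCoannihilator_eq _
    rw [Subspace.dual_finrank_eq, ← hN]
    refine Nat.add_le_add_left ?_ _
    have hNF : ∀ m ∈ N, ∀ e ∈ F, m.1 (u e) = m.1 (w e) := by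
      intro m hm e he
      refine sub_eq_zero.1 (hsep _ fun g ω hω => ?_)
      rw [← hφ]
      exact (Submodule.mem_dualCoannihilator _).1 hm _ (Submodule.subset_span
        (Set.mem_biUnion (show e ∈ (F : Set E(G)) from he) ⟨g, ω, hω, rfl⟩))
    obtain ⟨P, hP⟩ := exists_finpartition_fibers hV fun v => fun m : N => m.1.1 v
    have hconst : ∀ X : P.parts, ∀ x y : V(G), (x : α) ∈ (X : Set α) → (y : α) ∈ (X : Set α) →
        ∀ m : N, m.1.1 x = m.1.1 y := by
      rintro ⟨X, hX⟩ x y hx hy m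
      obtain ⟨v, rfl⟩ := hP X hX
      obtain ⟨_, hx⟩ := hx
      obtain ⟨_, hy⟩ := hy
      exact (congrFun hx m).trans (congrFun hy m).symm
    choose rep hrep using exists_mem_of_parts P
    have hfix : ∀ (X : P.parts) (m : N), m.1.1 (rep X) ∈ K X.1 := by
      intro X m
      refine hK _ _ fun v hv => ?_
      rw [hconst X _ _ (hrep X) hv]
      exact (Submodule.mem_pi.1 m.1.2) v (Set.mem_univ v)
    let L : N →ₗ[ℝ] ((X : P.parts) → K X.1) :=
      LinearMap.pi fun X => LinearMap.codRestrict _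
        (LinearMap.proj (rep X) ∘ₗ M.subtype ∘ₗ N.subtype) (hfix X)
    have hL : Function.Injective L := by
      intro m m' hmm
      refine Subtype.ext (Subtype.ext (funext fun v => ?_))
      obtain ⟨X, hX⟩ := exists_mem_parts P v
      rw [hconst X _ _ hX (hrep X) m, hconst X _ _ hX (hrep X) m']
      exact congrArg Subtype.val (congrFun hmm X)
    have h1 := LinearMap.finrank_le_finrank_of_injective hL
    rw [Module.finrank_pi_fintype] at h1
    have hsub : crossingEdges G P ⊆ ((Fᶜ.image Subtype.val : Finset β) : Set β) := by
      rintro e ⟨x, y, hxy, X, hX, Y, hY, hXY, hx, hy⟩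
      let e' : E(G) := ⟨e, hxy.edge_mem⟩
      refine Finset.mem_coe.2 (Finset.mem_image.2 ⟨e', ?_, rfl⟩)
      rw [Finset.mem_compl]
      intro he
      have hxy' : ∀ m : N, m.1.1 ⟨x, hxy.left_mem⟩ = m.1.1 ⟨y, hxy.right_mem⟩ := by
        intro m
        have h2 := hNF m.1 m.2 e' he
        rcases hxy.eq_and_eq_or_eq_and_eq (huw e') with ⟨h3, h4⟩ | ⟨h3, h4⟩
        · simpa [h3, h4] using h2
        · simpa [h3, h4] using h2.symm
      obtain ⟨v, rfl⟩ := hP X hX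
      obtain ⟨_, hx⟩ := hx
      refine hXY (congrArg Subtype.val (parts_eq_of_mem P (X := ⟨_, hX⟩) (Y := ⟨Y, hY⟩) (v := y)
        ⟨hxy.right_mem, ?_⟩ hy))
      rw [← hx]
      exact funext fun m => (hxy' m).symm
    calc finrank ℝ N ≤ _ := h1
      _ ≤ _ := h P
      _ ≤ _ := Set.ncard_le_ncard hsub
      _ ≤ Fᶜ.card := by
        rw [Set.ncard_coe_finset]
        exact Finset.card_image_le
  obtain ⟨x, hx, hspan⟩ := exists_transversal_span_eq_top S (fun e => ⟨_, g₀, ω₀, hω₀, rfl⟩) hS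
  choose b ω hω hxω using hx
  refine ⟨b, fun m hmK hm => ?_⟩
  let m' : M := ⟨m, Submodule.mem_pi.2 fun v _ => hmK v⟩
  -- The chosen forms vanish at `m'` and span the dual, so every form does.
  have hall : ∀ ψ : Dual ℝ M, ψ m' = 0 := by
    intro ψ
    have hψ : ψ ∈ Submodule.span ℝ (Set.range x) := by rw [hspan]; trivial
    induction hψ using Submodule.span_induction with
    | mem ψ hψ =>
      obtain ⟨e, rfl⟩ := hψ
      rw [hxω, hφ]
      exact hm e _ _ (huw e) _ (hω e)
    | zero => rfl
    | add y z _ _ hy hz => rw [LinearMap.add_apply, hy, hz, add_zero]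
    | smul c y _ hy => rw [LinearMap.smul_apply, hy, smul_zero]
  exact congrArg Subtype.val ((forall_dual_apply_eq_zero_iff ℝ m').1 hall)

end Count

/-! ### Application to pinned body-bar frameworks -/

theorem sum_finrank_le_of_isInfinitesimallyRigid {d : ℕ} (hd : 1 ≤ d) {G : Graph α β}
    (hE : E(G).Finite) {R : ρ → V(G)} {b : E(G) → Gr 2 (d + 1)} {p : ρ → Euc d}
    (h : IsInfinitesimallyRigid hd G R b p) (P : Finpartition V(G)) :
    ∑ X : P.parts, finrank ℝ (fixing hd (p '' rootsIn R X.1)) ≤ (crossingEdges G P).ncard := by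
  choose ω hω using fun e => (b e).exists_mem_pluckerVectors
  refine sum_finrank_le_ncard_crossingEdges hE (pairingDual hd) ω P
    (fun X => fixing hd (p '' rootsIn R X.1)) fun m hm hK => ?_
  refine h m ⟨fun e u v huv ω' hω' => ?_, fun r q => ?_⟩
  · obtain ⟨c, rfl⟩ := (b e).pluckerVectors_subset_span (hω e) hω'
    rw [← pairingDual_apply, map_smul]
    exact smul_eq_zero_of_right c (hm e u v huv)
  · obtain ⟨X, hX⟩ := exists_mem_parts P (R r)
    exact mem_fixing_rootsIn.1 (hK X _ hX) r hX q

theorem exists_isInfinitesimallyRigid {d : ℕ} (hd : 1 ≤ d) {G : Graph α β} (hV : V(G).Finite)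
    (hE : E(G).Finite) {R : ρ → V(G)} {p : ρ → Euc d}
    (h : ∀ P : Finpartition V(G),
      ∑ X : P.parts, finrank ℝ (fixing hd (p '' rootsIn R X.1)) ≤ (crossingEdges G P).ncard) :
    ∃ b : E(G) → Gr 2 (d + 1), IsInfinitesimallyRigid hd G R b p := by
  have := nonempty_gr (show 2 ≤ d + 1 by omega)
  obtain ⟨b, hb⟩ := exists_bars_of_partition_count hV hE (pairingDual hd)
    (fun X => fixing hd (p '' rootsIn R X))
    -- Fixing the pins of X means fixing those at each vertex of X.
    (fun X a ha => mem_fixing_rootsIn.2 fun r hr => mem_fixing_rootsIn.1 (ha (R r) hr) r rfl)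
    Gr.pluckerVectors Gr.exists_mem_pluckerVectors
    (fun a ha => eq_zero_of_forall_pairing_eq_zero hd ha) h
  refine ⟨b, fun m hm => hb m (fun v => mem_fixing_rootsIn.2 fun r hr q => ?_) hm.1⟩
  rw [← show R r = v from Subtype.ext hr]
  exact hm.2 r q

end BodyBar

open Classical in
theorem mainTheorem7 {α β ρ : Type*} [Finite ρ] {d : ℕ} (hd : 1 ≤ d)
    (G : Graph α β) (hV : V(G).Finite) (hE : E(G).Finite)
    (R : ρ → V(G)) (p : ρ → BodyBar.Euc d) :
    (∃ b : E(G) → BodyBar.Gr 2 (d + 1), BodyBar.IsInfinitesimallyRigid hd G R b p) ↔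
      ∀ P : Finpartition V(G),
        ((d + 1).choose 2 : ℤ) * P.parts.card -
            ∑ X ∈ P.parts with (BodyBar.rootsIn R X).Nonempty,
              ∑ i ∈ Finset.Icc 1 (BodyBar.affineDim (p '' BodyBar.rootsIn R X) + 1),
                ((d : ℤ) - i + 1) ≤
          (BodyBar.crossingEdges G P).ncard := by
  simp only [BodyBar.count_le_iff hd]
  exact ⟨fun ⟨_, h⟩ => BodyBar.sum_finrank_le_of_isInfinitesimallyRigid hd hE h,
    BodyBar.exists_isInfinitesimallyRigid hd hV hE⟩
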